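/- Let $d\ge 0$, $n\in\{3,4\}$ and $m_1,\dots,m_n>0$. A solution of the Newtonian $n$-body problem in $\mathbb{R}^d$ is a motion $X_1,\dots,X_n:I\to\mathbb{R}^d$ on an open interval $I\subseteq\mathbb{R}$ without collisions ($X_i(t)\ne X_j(t)$ for all $i\neq j$ and $t\in I$) that is twice differentiable and satisfies $$\ddot X_i=\sum_{j\ne i}\frac{m_j}{r_{ij}^3}\,(X_j-X_i),\qquad i=1,\dots,n,\qquad r_{ij}=|X_i-X_j|.$$ A solution is a relative equilibrium if all $\binom n2$ mutual distances $r_{ij}(t)$ are constant on $I$, and it is hinged if all but one of the mutual distances are constant on $I$ and the remaining one is not. Theorem. For every $d$ and all positive masses, the three- and four-body problems in $\mathbb{R}^d$ are unhinged, that is, they have no hinged solutions. In other words: for $n=3$, every solution on which two of the three mutual distances are constant is a relative equilibrium; for $n=4$, every solution on which five of the six mutual distances are constant is a relative equilibrium. -/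

import Mathlib

namespace NBody

/-- Newtonian acceleration of the `i`-th body (gravitational constant `1`) in the configuration `x`
of `n` bodies with masses `m`. -/
noncomputable def acceleration {n d : ℕ} (m : Fin n → ℝ)
    (x : Fin n → EuclideanSpace ℝ (Fin d)) (i : Fin n) : EuclideanSpace ℝ (Fin d) :=
  ∑ j ∈ Finset.univ.erase i, (m j / dist (x i) (x j) ^ 3) • (x j - x i)

/-- `(X, V)` is a (collision-free) solution of the `n`-body problem in `ℝ^d` with masses `m` on the
open time interval `I`, which may be all of `ℝ`. -/
structure IsSolution {n d : ℕ} (m : Fin n → ℝ) (I : Set ℝ)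
    (X V : ℝ → Fin n → EuclideanSpace ℝ (Fin d)) : Prop where
  isOpen : IsOpen I
  ordConnected : I.OrdConnected
  collisionFree : ∀ t ∈ I, ∀ i j, i ≠ j → X t i ≠ X t j
  velocity : ∀ t ∈ I, ∀ i, HasDerivAt (fun s => X s i) (V t i) t
  newton : ∀ t ∈ I, ∀ i, HasDerivAt (fun s => V s i) (acceleration m (X t) i) t

/-- The `n.choose 2` pairs `(i, j)` with `i < j`, indexing the mutual distances. -/
def pairs (n : ℕ) : Finset (Fin n × Fin n) :=
  Finset.univ.filter fun p => p.1 < p.2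

/-- The mutual distance between the two bodies of the pair `p` is constant on `I`. -/
def ConstantDistance {n d : ℕ} (I : Set ℝ) (X : ℝ → Fin n → EuclideanSpace ℝ (Fin d))
    (p : Fin n × Fin n) : Prop :=
  ∃ c : ℝ, ∀ t ∈ I, dist (X t p.1) (X t p.2) = c

/-- All mutual distances are constant. -/
def IsRelativeEquilibrium {n d : ℕ} (I : Set ℝ)
    (X : ℝ → Fin n → EuclideanSpace ℝ (Fin d)) : Prop :=
  ∀ p ∈ pairs n, ConstantDistance I X p

/-- All but one of the mutual distances are constant and the last one is not. -/
def IsHinged {n d : ℕ} (I : Set ℝ) (X : ℝ → Fin n → EuclideanSpace ℝ (Fin d)) : Prop :=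
  ∃ p ∈ pairs n, ¬ ConstantDistance I X p ∧ ∀ q ∈ pairs n, q ≠ p → ConstantDistance I X q

/-- The `n`-body problem in `ℝ^d` has no hinged solutions, whatever the positive masses. -/
def Unhinged (n d : ℕ) : Prop :=
  ∀ (m : Fin n → ℝ), (∀ i, 0 < m i) →
    ∀ (I : Set ℝ) (X V : ℝ → Fin n → EuclideanSpace ℝ (Fin d)),
      IsSolution m I X V → ¬ IsHinged I X

/-- Every solution of the `n`-body problem in `ℝ^d` with positive masses on which (at least) `k` of
the mutual distances are constant is a relative equilibrium. -/
def RigidWith (n d k : ℕ) : Prop :=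
  ∀ (m : Fin n → ℝ), (∀ i, 0 < m i) →
    ∀ (I : Set ℝ) (X V : ℝ → Fin n → EuclideanSpace ℝ (Fin d)), IsSolution m I X V →
      ∀ S ⊆ pairs n, S.card = k → (∀ p ∈ S, ConstantDistance I X p) →
        IsRelativeEquilibrium I X

end NBody

/-!
Let only `R = |Xₖ - Xₗ|` vary. Differentiating `|Xᵢ - Xⱼ|²` three times for a rigid pair `i, j`
gives `2 ⟪Ẋᵢ - Ẋⱼ, Ẍᵢ - Ẍⱼ⟫ = -d/dt ⟪Xᵢ - Xⱼ, Ẍᵢ - Ẍⱼ⟫`. By Newton's law the right-hand side is `Ṙ`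
times a function of the distances, and the left-hand side is a combination of the quantities
`⟪Ẋᵢ - Ẋⱼ, Xₚ - Xᵢ⟫`. Together with `Ṙ` these solve a homogeneous linear system whose coefficients
are polynomials in `R`, the other distances being constant. If `R` is not constant then it takes
infinitely many values at times where `Ṙ ≠ 0`, because its critical values form a null set. Hence
the determinant of the system vanishes identically, in particular at `R = 0`, where the system is
easy to solve. For three bodies this is already a contradiction. For four bodies it forces the
balance condition `mₖ (rᵢⱼ⁻³ - rⱼₖ⁻³) + mₗ (rᵢⱼ⁻³ - rⱼₗ⁻³) = 0` and the one with `i` and `j`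
exchanged. If `rᵢₖ ≠ rⱼₖ`, these make the equations of the faces `ikl` and `jkl` incompatible;
otherwise they eliminate the body `j` and the three-body equations reappear.
-/

namespace NBody

section Algebra

open Polynomial Matrix

theorem exists_mulVec_map_eval_eq_zero {ι R : Type*} [Fintype ι] [CommRing R] [IsDomain R]
    {T : Set R} (hT : T.Infinite) (M : Matrix ι ι R[X])
    (h : ∀ x ∈ T, ∃ v ≠ 0, M.map (eval x) *ᵥ v = 0) (a : R) :
    ∃ v ≠ 0, M.map (eval a) *ᵥ v = 0 := by
  classical
  have eval_det (x : R) : M.det.eval x = (M.map (eval x)).det := (evalRingHom x).map_det M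
  have det_eq_zero : M.det = 0 := eq_zero_of_infinite_isRoot _ <| hT.mono fun x hx =>
    (eval_det x).trans (exists_mulVec_eq_zero_iff.1 (h x hx))
  rw [exists_mulVec_eq_zero_iff, ← eval_det, det_eq_zero, eval_zero]

/-- The equations satisfied at a given time by a motion of bodies `1, 2, 3` along which only
`x = r₂₃` varies, at a speed `w = ẋ ≠ 0`. Here `s₁ = r₁₂⁻³`, `s₂ = r₁₃⁻³`, `e = r₁₂² - r₁₃²` and
`u = 4x ⟪V₁ - V₂, X₃ - X₁⟫`. The fields `left` and `right` come from differentiating the rigid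
distances `r₁₂` and `r₁₃` three times. -/
structure ThreeBodyHinge (s₁ s₂ e x u w : ℝ) : Prop where
  pos : 0 < x
  ne_zero : w ≠ 0
  left : (s₂ * x ^ 3 - 1) * u = -((2 * s₂ * x ^ 5 + x ^ 2 + 3 * e) * w)
  right : (s₁ * x ^ 3 - 1) * (4 * x ^ 2 * w - u) = -((2 * s₁ * x ^ 5 + x ^ 2 - 3 * e) * w)

theorem ThreeBodyHinge.face_sum {s₁ s₂ e x u w : ℝ} (h : ThreeBodyHinge s₁ s₂ e x u w) :
    (s₂ - s₁) * x * u + ((6 * s₁ + 2 * s₂) * x ^ 3 - 2) * w = 0 := by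
  apply mul_left_cancel₀ (pow_ne_zero 2 h.pos.ne')
  linear_combination h.left + h.right

theorem finite_setOf_threeBodyHinge (s₁ s₂ e : ℝ) :
    {x | ∃ u w, ThreeBodyHinge s₁ s₂ e x u w}.Finite := by
  by_contra hT
  let M : Matrix (Fin 2) (Fin 2) ℝ[X] :=
    !![C s₂ * X ^ 3 - 1, 2 * C s₂ * X ^ 5 + X ^ 2 + 3 * C e;
      C (s₂ - s₁) * X, C (6 * s₁ + 2 * s₂) * X ^ 3 - 2]
  have singular : ∀ x ∈ {x | ∃ u w, ThreeBodyHinge s₁ s₂ e x u w},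
      ∃ q ≠ 0, M.map (eval x) *ᵥ q = 0 := by
    rintro x ⟨u, w, h⟩
    have left : (s₂ * x ^ 3 - 1) * u + (2 * s₂ * x ^ 5 + x ^ 2 + 3 * e) * w = 0 := by
      linear_combination h.left
    refine ⟨![u, w], by simp [h.ne_zero], ?_⟩
    ext i
    fin_cases i
    · simpa [M, mulVec, dotProduct] using left
    · simpa [M, mulVec, dotProduct] using h.face_sum
  obtain ⟨q, hq, hMq⟩ := exists_mulVec_map_eval_eq_zero hT M singular 0
  have hw : q 1 = 0 := by simpa [M, mulVec, dotProduct] using congrFun hMq 1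
  have hu : q 0 = 0 := by simpa [M, mulVec, dotProduct, hw] using congrFun hMq 0
  exact hq (funext (Fin.forall_fin_two.2 ⟨hu, hw⟩))

/-- The equations satisfied at a given time by a motion of four bodies along which only `x = r₃₄`
varies, at a speed `w = ẋ ≠ 0`. Here `s = r₁₂⁻³`, `sᵢⱼ = rᵢⱼ⁻³`, `eᵢ = rᵢ₃² - rᵢ₄²` and, in terms of
`σᵢⱼₖ = ⟪Vᵢ - Vⱼ, Xₖ - Xᵢ⟫`, the unknowns are `y = 4x² σ₁₂₃`, `z = 4x² σ₁₂₄`, `u = 4x σ₁₃₄` and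
`v = 4x σ₂₃₄`. The field `pairij` comes from differentiating the rigid distance `rᵢⱼ` three times,
and `cocycle` relates the `σᵢⱼₖ` of the four faces of the tetrahedron. -/
structure FourBodyHinge (m₁ m₂ m₃ m₄ s s₁₃ s₁₄ s₂₃ s₂₄ e₁ e₂ x y z u v w : ℝ) : Prop where
  pos : 0 < x
  ne_zero : w ≠ 0
  pair13 : m₄ * ((s₁₄ * x ^ 3 - 1) * u) =
    -(m₄ * ((2 * s₁₄ * x ^ 5 + x ^ 2 + 3 * e₁) * w)) + m₂ * (s - s₂₃) * x ^ 2 * y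
  pair14 : m₃ * ((s₁₃ * x ^ 3 - 1) * (4 * x ^ 2 * w - u)) =
    -(m₃ * ((2 * s₁₃ * x ^ 5 + x ^ 2 - 3 * e₁) * w)) + m₂ * (s - s₂₄) * x ^ 2 * z
  pair23 : m₄ * ((s₂₄ * x ^ 3 - 1) * v) =
    -(m₄ * ((2 * s₂₄ * x ^ 5 + x ^ 2 + 3 * e₂) * w)) - m₁ * (s - s₁₃) * x ^ 2 * y
  pair24 : m₃ * ((s₂₃ * x ^ 3 - 1) * (4 * x ^ 2 * w - v)) =
    -(m₃ * ((2 * s₂₃ * x ^ 5 + x ^ 2 - 3 * e₂) * w)) - m₁ * (s - s₁₄) * x ^ 2 * z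
  pair12 : m₃ * (s₁₃ - s₂₃) * y + m₄ * (s₁₄ - s₂₄) * z = 0
  cocycle : y - z = x * (v - u)

namespace FourBodyHinge

variable {m₁ m₂ m₃ m₄ s s₁₃ s₁₄ s₂₃ s₂₄ e₁ e₂ x y z u v w : ℝ}

theorem swap (h : FourBodyHinge m₁ m₂ m₃ m₄ s s₁₃ s₁₄ s₂₃ s₂₄ e₁ e₂ x y z u v w) :
    FourBodyHinge m₂ m₁ m₃ m₄ s s₂₃ s₂₄ s₁₃ s₁₄ e₂ e₁ x (-y) (-z) v u w where
  pos := h.pos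
  ne_zero := h.ne_zero
  pair13 := by linear_combination h.pair23
  pair14 := by linear_combination h.pair24
  pair23 := by linear_combination h.pair13
  pair24 := by linear_combination h.pair14
  pair12 := by linear_combination h.pair12
  cocycle := by linear_combination -h.cocycle

theorem face_sum (h : FourBodyHinge m₁ m₂ m₃ m₄ s s₁₃ s₁₄ s₂₃ s₂₄ e₁ e₂ x y z u v w) :
    m₃ * m₄ * ((s₁₄ - s₁₃) * x * u + ((6 * s₁₃ + 2 * s₁₄) * x ^ 3 - 2) * w) =
      m₂ * (m₃ * (s - s₂₃) * y + m₄ * (s - s₂₄) * z) := by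
  apply mul_left_cancel₀ (pow_ne_zero 2 h.pos.ne')
  linear_combination m₃ * h.pair13 + m₄ * h.pair14

theorem weighted_face_sum (h : FourBodyHinge m₁ m₂ m₃ m₄ s s₁₃ s₁₄ s₂₃ s₂₄ e₁ e₂ x y z u v w)
    (h₃ : m₃ ≠ 0) (h₄ : m₄ ≠ 0) :
    m₁ * ((s₁₄ - s₁₃) * x * u + ((6 * s₁₃ + 2 * s₁₄) * x ^ 3 - 2) * w) +
      m₂ * ((s₂₄ - s₂₃) * x * v + ((6 * s₂₃ + 2 * s₂₄) * x ^ 3 - 2) * w) = 0 := by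
  apply mul_left_cancel₀ (mul_ne_zero h₃ h₄)
  linear_combination m₁ * h.face_sum + m₂ * h.swap.face_sum + m₁ * m₂ * h.pair12

/-- The coefficients of `face_sum`, `weighted_face_sum`, `pair13` and `pair23` as a linear system in
`y`, `u`, `v`, `w`, the unknown `z` being eliminated by `cocycle`. -/
noncomputable def coeffMatrix (m₁ m₂ m₃ m₄ s s₁₃ s₁₄ s₂₃ s₂₄ e₁ e₂ : ℝ) :
    Matrix (Fin 4) (Fin 4) ℝ[X] :=
  !![C (m₂ * (m₃ * (s - s₂₃) + m₄ * (s - s₂₄))),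
      C (m₂ * m₄ * (s - s₂₄) - m₃ * m₄ * (s₁₄ - s₁₃)) * X,
      -C (m₂ * m₄ * (s - s₂₄)) * X,
      -C (m₃ * m₄) * (C (6 * s₁₃ + 2 * s₁₄) * X ^ 3 - 2);
    0,
      C (m₁ * (s₁₄ - s₁₃)) * X,
      C (m₂ * (s₂₄ - s₂₃)) * X,
      C (m₁ * (6 * s₁₃ + 2 * s₁₄) + m₂ * (6 * s₂₃ + 2 * s₂₄)) * X ^ 3 - 2 * C (m₁ + m₂);
    -C (m₂ * (s - s₂₃)) * X ^ 2,
      C m₄ * (C s₁₄ * X ^ 3 - 1),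
      0,
      C m₄ * (2 * C s₁₄ * X ^ 5 + X ^ 2 + 3 * C e₁);
    C (m₁ * (s - s₁₃)) * X ^ 2,
      0,
      C m₄ * (C s₂₄ * X ^ 3 - 1),
      C m₄ * (2 * C s₂₄ * X ^ 5 + X ^ 2 + 3 * C e₂)]

theorem coeffMatrix_mulVec_eq_zero
    (h : FourBodyHinge m₁ m₂ m₃ m₄ s s₁₃ s₁₄ s₂₃ s₂₄ e₁ e₂ x y z u v w)
    (h₃ : m₃ ≠ 0) (h₄ : m₄ ≠ 0) :
    (coeffMatrix m₁ m₂ m₃ m₄ s s₁₃ s₁₄ s₂₃ s₂₄ e₁ e₂).map (eval x) *ᵥ ![y, u, v, w] = 0 := by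
  have face : m₂ * (m₃ * (s - s₂₃) + m₄ * (s - s₂₄)) * y +
      (m₂ * m₄ * (s - s₂₄) - m₃ * m₄ * (s₁₄ - s₁₃)) * x * u - m₂ * m₄ * (s - s₂₄) * x * v -
        m₃ * m₄ * ((6 * s₁₃ + 2 * s₁₄) * x ^ 3 - 2) * w = 0 := by
    linear_combination -h.face_sum + m₂ * m₄ * (s - s₂₄) * h.cocycle
  have total : m₁ * (s₁₄ - s₁₃) * x * u + m₂ * (s₂₄ - s₂₃) * x * v +
      ((m₁ * (6 * s₁₃ + 2 * s₁₄) + m₂ * (6 * s₂₃ + 2 * s₂₄)) * x ^ 3 - 2 * (m₁ + m₂)) * w = 0 := by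
    linear_combination h.weighted_face_sum h₃ h₄
  have pair13 : -(m₂ * (s - s₂₃) * x ^ 2 * y) + m₄ * (s₁₄ * x ^ 3 - 1) * u +
      m₄ * (2 * s₁₄ * x ^ 5 + x ^ 2 + 3 * e₁) * w = 0 := by
    linear_combination h.pair13
  have pair23 : m₁ * (s - s₁₃) * x ^ 2 * y + m₄ * (s₂₄ * x ^ 3 - 1) * v +
      m₄ * (2 * s₂₄ * x ^ 5 + x ^ 2 + 3 * e₂) * w = 0 := by
    linear_combination h.pair23
  ext i
  fin_cases i
  · simpa [coeffMatrix, mulVec, dotProduct, Fin.sum_univ_four, sub_eq_add_neg] using face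
  · simpa [coeffMatrix, mulVec, dotProduct, Fin.sum_univ_four] using total
  · simpa [coeffMatrix, mulVec, dotProduct, Fin.sum_univ_four] using pair13
  · simpa [coeffMatrix, mulVec, dotProduct, Fin.sum_univ_four] using pair23

theorem balance_of_infinite {T : Set ℝ} (hT : T.Infinite) (h₂ : m₂ ≠ 0) (h₃ : m₃ ≠ 0) (h₄ : m₄ ≠ 0)
    (h₁₂ : m₁ + m₂ ≠ 0) (h : ∀ x ∈ T, ∃ y z u v w,
      FourBodyHinge m₁ m₂ m₃ m₄ s s₁₃ s₁₄ s₂₃ s₂₄ e₁ e₂ x y z u v w) :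
    m₃ * (s - s₂₃) + m₄ * (s - s₂₄) = 0 := by
  by_contra hb
  obtain ⟨q, hq, hMq⟩ := exists_mulVec_map_eval_eq_zero hT
    (coeffMatrix m₁ m₂ m₃ m₄ s s₁₃ s₁₄ s₂₃ s₂₄ e₁ e₂) (fun x hx => by
      obtain ⟨y, z, u, v, w, h⟩ := h x hx
      exact ⟨![y, u, v, w], by simp [h.ne_zero], h.coeffMatrix_mulVec_eq_zero h₃ h₄⟩) 0
  have hw : q 3 = 0 := by
    simpa [coeffMatrix, mulVec, dotProduct, Fin.sum_univ_four, ← mul_add, ← neg_add, h₁₂]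
      using congrFun hMq 1
  have hy : q 0 = 0 := by
    simpa [coeffMatrix, mulVec, dotProduct, Fin.sum_univ_four, hw, hb, h₂] using congrFun hMq 0
  have hu : q 1 = 0 := by
    simpa [coeffMatrix, mulVec, dotProduct, Fin.sum_univ_four, hw, h₄] using congrFun hMq 2
  have hv : q 2 = 0 := by
    simpa [coeffMatrix, mulVec, dotProduct, Fin.sum_univ_four, hw, h₄] using congrFun hMq 3
  refine hq (funext fun i => ?_)
  fin_cases i <;> assumption

theorem faces_eq_zero_of_balance
    (h : FourBodyHinge m₁ m₂ m₃ m₄ s s₁₃ s₁₄ s₂₃ s₂₄ e₁ e₂ x y z u v w)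
    (h₃ : m₃ ≠ 0) (h₄ : m₄ ≠ 0)
    (b₁ : m₃ * (s - s₁₃) + m₄ * (s - s₁₄) = 0) (b₂ : m₃ * (s - s₂₃) + m₄ * (s - s₂₄) = 0)
    (hs : s₁₃ ≠ s₂₃) :
    (s₁₄ - s₁₃) * x * u + ((6 * s₁₃ + 2 * s₁₄) * x ^ 3 - 2) * w = 0 ∧
      (s₂₄ - s₂₃) * x * u + ((6 * s₂₃ + 2 * s₂₄) * x ^ 3 - 2) * w = 0 := by
  have hzy : z = y := by
    apply mul_left_cancel₀ (mul_ne_zero h₃ (sub_ne_zero.2 hs))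
    linear_combination -h.pair12 - z * (b₁ - b₂)
  have hvu : v = u := by
    apply mul_left_cancel₀ h.pos.ne'
    linear_combination -h.cocycle - hzy
  subst hzy hvu
  refine ⟨mul_left_cancel₀ (mul_ne_zero h₃ h₄) ?_, mul_left_cancel₀ (mul_ne_zero h₃ h₄) ?_⟩
  · linear_combination h.face_sum + m₂ * z * b₂
  · linear_combination h.swap.face_sum - m₁ * z * b₁

theorem sub_eq_sub_of_faces_eq_zero {T : Set ℝ} (hT : T.Infinite) (h : ∀ x ∈ T, ∃ u w, w ≠ 0 ∧
      (s₁₄ - s₁₃) * x * u + ((6 * s₁₃ + 2 * s₁₄) * x ^ 3 - 2) * w = 0 ∧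
      (s₂₄ - s₂₃) * x * u + ((6 * s₂₃ + 2 * s₂₄) * x ^ 3 - 2) * w = 0) :
    s₁₄ - s₁₃ = s₂₄ - s₂₃ := by
  let M : Matrix (Fin 2) (Fin 2) ℝ[X] :=
    !![C (s₁₄ - s₁₃), C (6 * s₁₃ + 2 * s₁₄) * X ^ 3 - 2;
      C (s₂₄ - s₂₃), C (6 * s₂₃ + 2 * s₂₄) * X ^ 3 - 2]
  have singular : ∀ x ∈ T, ∃ q ≠ 0, M.map (eval x) *ᵥ q = 0 := fun x hx => by
    obtain ⟨u, w, hw, h₁, h₂⟩ := h x hx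
    refine ⟨![x * u, w], by simp [hw], ?_⟩
    ext i
    fin_cases i
    · simpa [M, mulVec, dotProduct, mul_assoc] using h₁
    · simpa [M, mulVec, dotProduct, mul_assoc] using h₂
  obtain ⟨q, hq, hMq⟩ := exists_mulVec_map_eval_eq_zero hT M singular 0
  have h₁ : (s₁₄ - s₁₃) * q 0 + -(2 * q 1) = 0 := by
    simpa [M, mulVec, dotProduct] using congrFun hMq 0
  have h₂ : (s₂₄ - s₂₃) * q 0 + -(2 * q 1) = 0 := by
    simpa [M, mulVec, dotProduct] using congrFun hMq 1
  have hq₀ : q 0 ≠ 0 := fun h₀ => hq (funext (Fin.forall_fin_two.2 ⟨h₀, by simpa [h₀] using h₁⟩))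
  apply mul_right_cancel₀ hq₀
  linear_combination h₁ - h₂

theorem eq_of_balance {T : Set ℝ} (hT : T.Infinite) (h₃ : m₃ ≠ 0) (h₄ : m₄ ≠ 0)
    (h : ∀ x ∈ T, ∃ y z u v w,
      FourBodyHinge m₁ m₂ m₃ m₄ s s₁₃ s₁₄ s₂₃ s₂₄ e₁ e₂ x y z u v w)
    (b₁ : m₃ * (s - s₁₃) + m₄ * (s - s₁₄) = 0) (b₂ : m₃ * (s - s₂₃) + m₄ * (s - s₂₄) = 0) :
    s₁₃ = s₂₃ := by
  by_contra hs
  have faces : ∀ x ∈ T, ∃ u w, w ≠ 0 ∧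
      (s₁₄ - s₁₃) * x * u + ((6 * s₁₃ + 2 * s₁₄) * x ^ 3 - 2) * w = 0 ∧
      (s₂₄ - s₂₃) * x * u + ((6 * s₂₃ + 2 * s₂₄) * x ^ 3 - 2) * w = 0 := fun x hx => by
    obtain ⟨y, z, u, v, w, h⟩ := h x hx
    exact ⟨u, w, h.ne_zero, h.faces_eq_zero_of_balance h₃ h₄ b₁ b₂ hs⟩
  have hsub := sub_eq_sub_of_faces_eq_zero hT faces
  obtain ⟨x, hx⟩ := hT.nonempty
  obtain ⟨y, z, u, v, w, h⟩ := h x hx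
  obtain ⟨face₁, face₂⟩ := h.faces_eq_zero_of_balance h₃ h₄ b₁ b₂ hs
  apply hs
  apply mul_left_cancel₀ (mul_ne_zero (pow_ne_zero 3 h.pos.ne') h.ne_zero)
  linear_combination (face₁ - face₂ - (x * u + 2 * x ^ 3 * w) * hsub) / 8

theorem threeBodyHinge {s₁ s₂ e : ℝ}
    (h : FourBodyHinge m₁ m₂ m₃ m₄ s s₁ s₂ s₁ s₂ e e x y z u v w)
    (h₃ : m₃ ≠ 0) (h₄ : m₄ ≠ 0) (h₁₂ : m₁ + m₂ ≠ 0) (hM : m₁ + m₂ + m₃ + m₄ ≠ 0)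
    (b : m₃ * (s - s₁) + m₄ * (s - s₂) = 0) : ThreeBodyHinge s₁ s₂ e x u w := by
  have hx := h.pos.ne'
  -- Bodies 1 and 2 now enter alike: `pair13` and `pair23` differ only in `y`, `u` and `v`.
  have huv : (s - s₁) * (u - v) = 0 := by
    apply mul_left_cancel₀ (mul_ne_zero (mul_ne_zero hM h₃) (pow_ne_zero 3 hx))
    linear_combination m₃ * (h.pair13 - h.pair23) + m₄ * (h.pair14 - h.pair24)
      + m₃ * (m₁ + m₂) * (s - s₁) * x ^ 2 * h.cocycle
      + ((m₁ + m₂) * x ^ 2 * z + m₃ * x ^ 3 * (u - v)) * b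
  have hy : (s - s₁) * y = 0 := by
    suffices ((s - s₁) * y) * ((s - s₁) * y) = 0 from mul_self_eq_zero.1 this
    apply mul_left_cancel₀ (mul_ne_zero h₁₂ (pow_ne_zero 2 hx))
    linear_combination (s - s₁) * y * (h.pair23 - h.pair13) +
      m₄ * (s₂ * x ^ 3 - 1) * y * huv
  have hz : (s - s₂) * z = 0 := by
    apply mul_left_cancel₀ h₄
    linear_combination -m₃ * x * huv - m₃ * hy + m₃ * (s - s₁) * h.cocycle + z * b
  refine ⟨h.pos, h.ne_zero, mul_left_cancel₀ h₄ ?_, mul_left_cancel₀ h₃ ?_⟩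
  · linear_combination h.pair13 + m₂ * x ^ 2 * hy
  · linear_combination h.pair14 + m₂ * x ^ 2 * hz

end FourBodyHinge

theorem finite_setOf_fourBodyHinge {m₁ m₂ m₃ m₄ s s₁₃ s₁₄ s₂₃ s₂₄ e₁ e₂ : ℝ} (h₁ : 0 < m₁)
    (h₂ : 0 < m₂) (h₃ : 0 < m₃) (h₄ : 0 < m₄) (he : s₁₃ = s₂₃ → s₁₄ = s₂₄ → e₁ = e₂) :
    {x | ∃ y z u v w,
      FourBodyHinge m₁ m₂ m₃ m₄ s s₁₃ s₁₄ s₂₃ s₂₄ e₁ e₂ x y z u v w}.Finite := by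
  by_contra hT
  have b₂ := FourBodyHinge.balance_of_infinite hT h₂.ne' h₃.ne' h₄.ne' (by positivity)
    fun _ hx => hx
  have b₁ := FourBodyHinge.balance_of_infinite hT h₁.ne' h₃.ne' h₄.ne' (by positivity)
    fun _ ⟨_, _, _, _, _, h⟩ => ⟨_, _, _, _, _, h.swap⟩
  obtain rfl := FourBodyHinge.eq_of_balance hT h₃.ne' h₄.ne' (fun _ hx => hx) b₁ b₂
  obtain rfl : s₁₄ = s₂₄ := by
    apply mul_left_cancel₀ h₄.ne'
    linear_combination b₂ - b₁
  obtain rfl := he rfl rfl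
  refine hT ((finite_setOf_threeBodyHinge s₁₃ s₁₄ e₁).subset ?_)
  rintro x ⟨y, z, u, v, w, h⟩
  exact ⟨u, w, h.threeBodyHinge h₃.ne' h₄.ne' (by positivity) (by positivity) b₁⟩

end Algebra

section Calculus

open Set MeasureTheory

theorem infinite_image_of_deriv_ne_zero {I : Set ℝ} (hI : I.OrdConnected) {f f' : ℝ → ℝ}
    (hf : ∀ t ∈ I, HasDerivAt f (f' t) t) (hne : ¬ ∃ c, ∀ t ∈ I, f t = c) :
    (f '' {t ∈ I | f' t ≠ 0}).Infinite := by
  intro hfin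
  have null_critical : volume (f '' {t ∈ I | f' t = 0}) = 0 := by
    refine addHaar_image_eq_zero_of_det_fderivWithin_eq_zero volume
      (fun t ht => (hf t ht.1).hasFDerivAt.hasFDerivWithinAt) fun t ht => ?_
    rw [ContinuousLinearMap.det_toSpanSingleton, ht.2]
  have null_image : volume (f '' I) = 0 := by
    refine measure_mono_null ?_ (measure_union_null null_critical (hfin.measure_zero volume))
    rw [← image_union]
    exact image_mono fun t ht => (em (f' t = 0)).imp (⟨ht, ·⟩) (⟨ht, ·⟩)
  have ordConnected_image : (f '' I).OrdConnected :=
    (hI.isPreconnected.image f fun t ht => (hf t ht).continuousAt.continuousWithinAt).ordConnected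
  have subsingleton_image : (f '' I).Subsingleton := fun a ha b hb => by
    have := measure_mono_null (ordConnected_image.uIcc_subset ha hb) null_image
    rw [Real.volume_interval, ENNReal.ofReal_eq_zero] at this
    exact (sub_eq_zero.1 (abs_nonpos_iff.1 this)).symm
  rcases I.eq_empty_or_nonempty with rfl | ⟨a, ha⟩
  · simp at hne
  · exact hne ⟨f a, fun t ht =>
      subsingleton_image (mem_image_of_mem f ht) (mem_image_of_mem f ha)⟩

end Calculus

section InvCubeDist

variable {ι E : Type*} [PseudoMetricSpace E] {x x' : ι → E} {i j k l : ι}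

/-- The inverse cube of a mutual distance in the configuration `x`, the coefficient in Newton's law.
It is `0` at a collision, in particular for `i = j`. -/
noncomputable def invCubeDist (x : ι → E) (i j : ι) : ℝ := (dist (x i) (x j) ^ 3)⁻¹

theorem invCubeDist_comm (x : ι → E) (i j : ι) : invCubeDist x i j = invCubeDist x j i := by
  rw [invCubeDist, invCubeDist, dist_comm]

theorem invCubeDist_congr (h : dist (x i) (x j) = dist (x' k) (x' l)) :
    invCubeDist x i j = invCubeDist x' k l := by
  rw [invCubeDist, invCubeDist, h]

theorem dist_eq_of_invCubeDist_eq (h : invCubeDist x i j = invCubeDist x' k l) :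
    dist (x i) (x j) = dist (x' k) (x' l) :=
  (pow_left_inj₀ dist_nonneg dist_nonneg three_ne_zero).1 (inv_injective h)

end InvCubeDist

section InnerProductSpace

variable {E : Type*} [NormedAddCommGroup E] [InnerProductSpace ℝ E]

open scoped RealInnerProductSpace

theorem inner_sub_sub_eq_of_hasDerivAt_dist {x y : ℝ → E} {x' y' : E} {t r' : ℝ}
    (hx : HasDerivAt x x' t) (hy : HasDerivAt y y' t)
    (hr : HasDerivAt (fun s => dist (x s) (y s)) r' t) :
    ⟪x' - y', x t - y t⟫ = dist (x t) (y t) * r' := by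
  have deriv_norm_sq := (hx.fun_sub hy).norm_sq
  have deriv_dist_sq := hr.fun_pow 2
  simp only [dist_eq_norm] at deriv_dist_sq ⊢
  have := deriv_norm_sq.unique deriv_dist_sq
  rw [real_inner_comm]
  push_cast at this
  linarith

/-- Differentiating `⟪x, x''⟫ = -‖x'‖ ^ 2`, which holds because `‖x‖` is constant. -/
theorem two_mul_inner_deriv_deriv_deriv {I : Set ℝ} (hI : IsOpen I) {x v a : ℝ → E}
    (hx : ∀ t ∈ I, HasDerivAt x (v t) t) (hv : ∀ t ∈ I, HasDerivAt v (a t) t) {c : ℝ}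
    (hc : ∀ t ∈ I, ‖x t‖ = c) {f' t : ℝ} (ht : t ∈ I)
    (hf : HasDerivAt (fun s => ⟪x s, a s⟫) f' t) : 2 * ⟪v t, a t⟫ = -f' := by
  have unique {f g : ℝ → ℝ} {f' g' s : ℝ} (hs : s ∈ I) (hfg : ∀ s ∈ I, f s = g s)
      (hf : HasDerivAt f f' s) (hg : HasDerivAt g g' s) : f' = g' :=
    hf.unique (hg.congr_of_eventuallyEq (Filter.eventually_of_mem (hI.mem_nhds hs) hfg))
  have inner_x_v (s) (hs : s ∈ I) : ⟪x s, v s⟫ = 0 := by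
    have := unique hs (fun s hs => by rw [hc s hs]) (hx s hs).norm_sq (hasDerivAt_const s (c ^ 2))
    linarith
  have norm_v_sq (s) (hs : s ∈ I) : ‖v s‖ ^ 2 = -⟪x s, a s⟫ := by
    have := unique hs inner_x_v ((hx s hs).inner ℝ (hv s hs)) (hasDerivAt_const s (0 : ℝ))
    rw [real_inner_self_eq_norm_sq] at this
    linarith
  exact unique ht norm_v_sq (hv t ht).norm_sq hf.neg

theorem inner_sub_sub_eq_dist (a b c : E) :
    ⟪a - b, c - a⟫ = (dist b c ^ 2 - dist a b ^ 2 - dist a c ^ 2) / 2 := by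
  rw [dist_eq_norm, dist_eq_norm, dist_eq_norm]
  simp only [@norm_sub_sq_real, inner_sub_left, inner_sub_right, real_inner_self_eq_norm_sq,
    real_inner_comm b a]
  ring

variable {ι : Type*}

/-- The rate `⟪vᵢ - vⱼ, xₖ - xᵢ⟫` at which a motion with velocities `v` turns the side `ij` of the
triangle `ijk` towards `k`. It is alternating in `i`, `j`, `k` up to the derivatives of the squared
sides, hence a single unknown for a rigid triangle. -/
def spin (x v : ι → E) (i j k : ι) : ℝ := ⟪v i - v j, x k - x i⟫

theorem spin_left (x v : ι → E) (i j : ι) : spin x v i j i = 0 := by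
  rw [spin, sub_self, inner_zero_right]

theorem spin_right (x v : ι → E) (i j : ι) : spin x v i j j = -⟪v i - v j, x i - x j⟫ := by
  rw [spin, ← neg_sub (x i), inner_neg_right]

theorem spin_swap_left (x v : ι → E) (i j k : ι) :
    spin x v j i k = -spin x v i j k - ⟪v i - v j, x i - x j⟫ := by
  simp only [spin, inner_sub_left, inner_sub_right]
  ring

theorem spin_swap_right (x v : ι → E) (i j k : ι) :
    spin x v i k j = -spin x v i j k + ⟪v j - v k, x j - x k⟫ - ⟪v i - v j, x i - x j⟫
      - ⟪v i - v k, x i - x k⟫ := by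
  simp only [spin, inner_sub_left, inner_sub_right]
  ring

theorem spin_cocycle (x v : ι → E) (i j k l : ι) :
    spin x v j k l - spin x v i k l + spin x v i j l - spin x v i j k =
      ⟪v i - v k, x i - x k⟫ - ⟪v j - v k, x j - x k⟫ := by
  simp only [spin, inner_sub_left, inner_sub_right]
  ring

end InnerProductSpace

section Newton

open Finset
open scoped RealInnerProductSpace

/-- The contribution of a unit mass at `x₃` to `⟪x₁ - x₂, ẍ₁ - ẍ₂⟫`, as a function of the distances
`a = r₁₂`, `b = r₁₃` and `c = r₂₃`. At
`x₃ = x₁` the first term is `0 / 0 = 0`, so that a body exerts no pull on itself. -/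
noncomputable def axialPull (a b c : ℝ) : ℝ :=
  ((c ^ 2 - a ^ 2 - b ^ 2) / b ^ 3 + (b ^ 2 - a ^ 2 - c ^ 2) / c ^ 3) / 2

theorem hasDerivAt_axialPull (a b : ℝ) {c : ℝ} (hc : c ≠ 0) :
    HasDerivAt (axialPull a b)
      ((2 * (b ^ 3)⁻¹ * c ^ 5 + c ^ 2 + 3 * (a ^ 2 - b ^ 2)) / (2 * c ^ 4)) c := by
  have hsq := hasDerivAt_pow 2 c
  have := ((((hsq.sub_const (a ^ 2)).sub_const (b ^ 2)).div_const (b ^ 3)).add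
    ((hsq.const_sub (b ^ 2 - a ^ 2)).div (hasDerivAt_pow 3 c) (pow_ne_zero 3 hc))).div_const 2
  refine this.congr_deriv ?_
  push_cast
  field_simp
  ring

variable {n d : ℕ} {m : Fin n → ℝ} {I : Set ℝ} {X V : ℝ → Fin n → EuclideanSpace ℝ (Fin d)}

theorem acceleration_eq_sum_invCubeDist (m : Fin n → ℝ) (x : Fin n → EuclideanSpace ℝ (Fin d))
    (i : Fin n) : acceleration m x i = ∑ l, (m l * invCubeDist x i l) • (x l - x i) := by
  simp only [acceleration, div_eq_mul_inv, invCubeDist]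
  exact sum_erase _ (by rw [sub_self, smul_zero])

theorem inner_acceleration_sub (m : Fin n → ℝ) (x : Fin n → EuclideanSpace ℝ (Fin d))
    (i j : Fin n) :
    ⟪x i - x j, acceleration m x i - acceleration m x j⟫ =
      ∑ l, m l * axialPull (dist (x i) (x j)) (dist (x i) (x l)) (dist (x j) (x l)) := by
  simp only [acceleration_eq_sum_invCubeDist, ← sum_sub_distrib, inner_sum]
  refine sum_congr rfl fun l _ => ?_
  have hi := inner_sub_sub_eq_dist (x i) (x j) (x l)
  have hj := inner_sub_sub_eq_dist (x j) (x i) (x l)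
  rw [dist_comm (x j) (x i), ← neg_sub, inner_neg_left] at hj
  rw [inner_sub_right, inner_smul_right, inner_smul_right, hi, axialPull, invCubeDist, invCubeDist]
  linear_combination (m l * (dist (x j) (x l) ^ 3)⁻¹) * hj

theorem inner_velocity_acceleration_sub (m : Fin n → ℝ) {x v : Fin n → EuclideanSpace ℝ (Fin d)}
    {i j : Fin n} (hij : ⟪v i - v j, x i - x j⟫ = 0) :
    ⟪v i - v j, acceleration m x i - acceleration m x j⟫ =
      ∑ l ∈ {i, j}ᶜ, m l * (invCubeDist x i l - invCubeDist x j l) * spin x v i j l := by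
  have spin_eq (l : Fin n) : ⟪v i - v j, x l - x j⟫ = spin x v i j l := by
    rw [spin, ← sub_add_sub_cancel (x l) (x i), inner_add_right, hij, add_zero]
  rw [sum_subset (subset_univ _) fun l _ hl => ?_]
  · simp only [acceleration_eq_sum_invCubeDist, ← sum_sub_distrib, inner_sum]
    refine sum_congr rfl fun l _ => ?_
    rw [inner_sub_right, inner_smul_right, inner_smul_right, spin_eq, spin]
    ring
  · rw [mem_compl, not_not, mem_insert, mem_singleton] at hl
    rcases hl with rfl | rfl
    · rw [spin_left, mul_zero]
    · rw [spin_right, hij, neg_zero, mul_zero]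

/-- All mutual distances except possibly that of `k` and `l` are constant. -/
def IsRigidExcept (I : Set ℝ) (X : ℝ → Fin n → EuclideanSpace ℝ (Fin d)) (k l : Fin n) : Prop :=
  ∀ i, i ≠ k → i ≠ l → ∀ j, ConstantDistance I X (i, j)

namespace IsRigidExcept

variable {i j k l : Fin n}

theorem symm (hr : IsRigidExcept I X k l) : IsRigidExcept I X l k :=
  fun i hil hik => hr i hik hil

theorem dist_eq (hr : IsRigidExcept I X k l) (hik : i ≠ k) (hil : i ≠ l) (j : Fin n) {t t₀ : ℝ}
    (ht : t ∈ I) (ht₀ : t₀ ∈ I) : dist (X t i) (X t j) = dist (X t₀ i) (X t₀ j) := by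
  obtain ⟨c, hc⟩ := hr i hik hil j
  exact (hc t ht).trans (hc t₀ ht₀).symm

end IsRigidExcept

namespace IsSolution

variable {i j k l : Fin n} {t R' : ℝ}

theorem hasDerivAt_sub (h : IsSolution m I X V) (i j : Fin n) (ht : t ∈ I) :
    HasDerivAt (fun s => X s i - X s j) (V t i - V t j) t :=
  (h.velocity t ht i).sub (h.velocity t ht j)

theorem hasDerivAt_velocity_sub (h : IsSolution m I X V) (i j : Fin n) (ht : t ∈ I) :
    HasDerivAt (fun s => V s i - V s j) (acceleration m (X t) i - acceleration m (X t) j) t :=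
  (h.newton t ht i).sub (h.newton t ht j)

theorem hasDerivAt_dist (h : IsSolution m I X V) (hij : i ≠ j) (ht : t ∈ I) :
    HasDerivAt (fun s => dist (X s i) (X s j)) (deriv (fun s => dist (X s i) (X s j)) t) t :=
  ((h.velocity t ht i).differentiableAt.dist ℝ (h.velocity t ht j).differentiableAt
    (h.collisionFree t ht i j hij)).hasDerivAt

theorem inner_velocity_sub_eq_zero (h : IsSolution m I X V) (hij : ConstantDistance I X (i, j))
    (ht : t ∈ I) : ⟪V t i - V t j, X t i - X t j⟫ = 0 := by
  obtain ⟨c, hc⟩ := hij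
  rw [inner_sub_sub_eq_of_hasDerivAt_dist (h.velocity t ht i) (h.velocity t ht j)
    ((hasDerivAt_const t c).congr_of_eventuallyEq
      (Filter.eventually_of_mem (h.isOpen.mem_nhds ht) hc)), mul_zero]

theorem sum_invCubeDist_mul_spin (h : IsSolution m I X V) (hij : ConstantDistance I X (i, j))
    (ht : t ∈ I) {f' : ℝ} (hf : HasDerivAt (fun s => ∑ l, m l *
      axialPull (dist (X s i) (X s j)) (dist (X s i) (X s l)) (dist (X s j) (X s l))) f' t) :
    2 * ∑ l ∈ {i, j}ᶜ, m l * (invCubeDist (X t) i l - invCubeDist (X t) j l) *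
      spin (X t) (V t) i j l = -f' := by
  rw [← inner_velocity_acceleration_sub m (h.inner_velocity_sub_eq_zero hij ht)]
  obtain ⟨c, hc⟩ := hij
  simp only [← inner_acceleration_sub] at hf
  exact two_mul_inner_deriv_deriv_deriv h.isOpen (fun s hs => h.hasDerivAt_sub i j hs)
    (fun s hs => h.hasDerivAt_velocity_sub i j hs)
    (fun s hs => (dist_eq_norm _ _).symm.trans (hc s hs)) ht hf

theorem axis_equation (h : IsSolution m I X V) (hr : IsRigidExcept I X k l) (hik : i ≠ k)
    (hil : i ≠ l) (hjk : j ≠ k) (hjl : j ≠ l) (ht : t ∈ I) :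
    ∑ p ∈ {i, j}ᶜ, m p * (invCubeDist (X t) i p - invCubeDist (X t) j p) *
      spin (X t) (V t) i j p = 0 := by
  have hpull : HasDerivAt (fun s => ∑ p, m p *
      axialPull (dist (X s i) (X s j)) (dist (X s i) (X s p)) (dist (X s j) (X s p))) 0 t :=
    (hasDerivAt_const t _).congr_of_eventuallyEq <|
      Filter.eventually_of_mem (h.isOpen.mem_nhds ht) fun s hs => by
        simp only [hr.dist_eq hik hil _ hs ht, hr.dist_eq hjk hjl _ hs ht]
        rfl
  have := h.sum_invCubeDist_mul_spin (hr i hik hil j) ht hpull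
  linarith

theorem hasDerivAt_sum_axialPull (h : IsSolution m I X V) (hr : IsRigidExcept I X k l)
    (hkl : k ≠ l) (hik : i ≠ k) (hil : i ≠ l) (ht : t ∈ I)
    (hR : HasDerivAt (fun s => dist (X s k) (X s l)) R' t) :
    HasDerivAt (fun s => ∑ p, m p *
        axialPull (dist (X s i) (X s k)) (dist (X s i) (X s p)) (dist (X s k) (X s p)))
      (m l * ((2 * invCubeDist (X t) i l * dist (X t k) (X t l) ^ 5 + dist (X t k) (X t l) ^ 2 +
        3 * (dist (X t i) (X t k) ^ 2 - dist (X t i) (X t l) ^ 2)) /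
          (2 * dist (X t k) (X t l) ^ 4) * R')) t := by
  have hkl0 : dist (X t k) (X t l) ≠ 0 := dist_ne_zero.2 (h.collisionFree t ht k l hkl)
  have hpull := ((hasDerivAt_axialPull (dist (X t i) (X t k)) (dist (X t i) (X t l))
    hkl0).comp t hR).const_mul (m l)
  refine (hpull.add_const (∑ p ∈ univ.erase l, m p * axialPull (dist (X t i) (X t k))
    (dist (X t i) (X t p)) (dist (X t k) (X t p)))).congr_of_eventuallyEq <|
      Filter.eventually_of_mem (h.isOpen.mem_nhds ht) fun s hs => ?_
  dsimp only
  rw [← add_sum_erase _ _ (mem_univ l)]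
  refine congrArg₂ _ ?_ (sum_congr rfl fun p hp => ?_)
  · rw [hr.dist_eq hik hil k hs ht, hr.dist_eq hik hil l hs ht, Function.comp_apply]
  · have hkp : dist (X s k) (X s p) = dist (X t k) (X t p) := by
      rcases eq_or_ne p k with rfl | hpk
      · rw [dist_self, dist_self]
      · rw [dist_comm, hr.dist_eq hpk (ne_of_mem_erase hp) k hs ht, dist_comm]
    rw [hr.dist_eq hik hil k hs ht, hr.dist_eq hik hil p hs ht, hkp]

theorem leg_equation (h : IsSolution m I X V) (hr : IsRigidExcept I X k l) (hkl : k ≠ l)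
    (hik : i ≠ k) (hil : i ≠ l) (ht : t ∈ I)
    (hR : HasDerivAt (fun s => dist (X s k) (X s l)) R' t) :
    m l * ((invCubeDist (X t) i l * dist (X t k) (X t l) ^ 3 - 1) *
        (4 * dist (X t k) (X t l) * spin (X t) (V t) i k l)) =
      -(m l * ((2 * invCubeDist (X t) i l * dist (X t k) (X t l) ^ 5 + dist (X t k) (X t l) ^ 2 +
        3 * (dist (X t i) (X t k) ^ 2 - dist (X t i) (X t l) ^ 2)) * R')) +
      4 * dist (X t k) (X t l) ^ 4 * ∑ p ∈ {i, k, l}ᶜ,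
        m p * (invCubeDist (X t) i p - invCubeDist (X t) p k) * spin (X t) (V t) i p k := by
  have hR0 : dist (X t k) (X t l) ≠ 0 := dist_ne_zero.2 (h.collisionFree t ht k l hkl)
  have hsum := h.sum_invCubeDist_mul_spin (hr i hik hil k) ht
    (h.hasDerivAt_sum_axialPull hr hkl hik hil ht hR)
  have hspin : ∀ p ∈ ({i, k, l}ᶜ : Finset (Fin n)), m p * (invCubeDist (X t) i p -
      invCubeDist (X t) k p) * spin (X t) (V t) i k p = -(m p * (invCubeDist (X t) i p -
      invCubeDist (X t) p k) * spin (X t) (V t) i p k) := fun p hp => by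
    simp only [mem_compl, mem_insert, mem_singleton, not_or] at hp
    rw [spin_swap_right, h.inner_velocity_sub_eq_zero (hr i hik hil p) ht,
      h.inner_velocity_sub_eq_zero (hr i hik hil k) ht,
      h.inner_velocity_sub_eq_zero (hr p hp.2.1 hp.2.2 k) ht, invCubeDist_comm (X t) k p]
    ring
  have hl : l ∈ ({i, k}ᶜ : Finset (Fin n)) := by simp [hil.symm, hkl.symm]
  have herase : ({i, k}ᶜ : Finset (Fin n)).erase l = {i, k, l}ᶜ := by
    ext p
    simp only [mem_erase, mem_compl, mem_insert, mem_singleton]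
    tauto
  rw [← add_sum_erase _ _ hl, herase,
    sum_congr rfl hspin, sum_neg_distrib] at hsum
  rw [invCubeDist.eq_def (X t) k l] at hsum
  field_simp at hsum
  linear_combination hsum

end IsSolution

end Newton

section Hinge

variable {d : ℕ} {I : Set ℝ} {t R' : ℝ}

theorem IsSolution.spin_swap_hinge {n : ℕ} {m : Fin n → ℝ}
    {X V : ℝ → Fin n → EuclideanSpace ℝ (Fin d)} {i k l : Fin n} (h : IsSolution m I X V)
    (hr : IsRigidExcept I X k l) (hik : i ≠ k) (hil : i ≠ l) (ht : t ∈ I)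
    (hR : HasDerivAt (fun s => dist (X s k) (X s l)) R' t) :
    spin (X t) (V t) i l k = dist (X t k) (X t l) * R' - spin (X t) (V t) i k l := by
  rw [spin_swap_right, h.inner_velocity_sub_eq_zero (hr i hik hil k) ht,
    h.inner_velocity_sub_eq_zero (hr i hik hil l) ht,
    inner_sub_sub_eq_of_hasDerivAt_dist (h.velocity t ht k) (h.velocity t ht l) hR]
  ring

theorem IsSolution.threeBodyHinge {m : Fin 3 → ℝ} (hm : ∀ i, m i ≠ 0)
    {X V : ℝ → Fin 3 → EuclideanSpace ℝ (Fin d)} {i k l : Fin 3} (h : IsSolution m I X V)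
    (hr : IsRigidExcept I X k l) (hkl : k ≠ l) (hik : i ≠ k) (hil : i ≠ l) (ht : t ∈ I)
    (hR : HasDerivAt (fun s => dist (X s k) (X s l)) R' t) (hR' : R' ≠ 0) :
    ThreeBodyHinge (invCubeDist (X t) i k) (invCubeDist (X t) i l)
      (dist (X t i) (X t k) ^ 2 - dist (X t i) (X t l) ^ 2) (dist (X t k) (X t l))
      (4 * dist (X t k) (X t l) * spin (X t) (V t) i k l) R' := by
  have no_other_body : ({i, k, l}ᶜ : Finset (Fin 3)) = ∅ ∧ ({i, l, k}ᶜ : Finset (Fin 3)) = ∅ := by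
    clear * - hkl hik hil
    decide +revert
  have left := h.leg_equation hr hkl hik hil ht hR
  have right := h.leg_equation hr.symm hkl.symm hil hik ht (by simpa only [dist_comm] using hR)
  rw [dist_comm (X t l), h.spin_swap_hinge hr hik hil ht hR, no_other_body.2,
    Finset.sum_empty] at right
  rw [no_other_body.1, Finset.sum_empty] at left
  refine ⟨dist_pos.2 (h.collisionFree t ht k l hkl), hR', mul_left_cancel₀ (hm l) ?_,
    mul_left_cancel₀ (hm k) ?_⟩
  · linear_combination left
  · linear_combination right

theorem IsSolution.fourBodyHinge {m : Fin 4 → ℝ} {X V : ℝ → Fin 4 → EuclideanSpace ℝ (Fin d)}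
    {i j k l : Fin 4} (h : IsSolution m I X V) (hr : IsRigidExcept I X k l) (hij : i ≠ j)
    (hkl : k ≠ l) (hik : i ≠ k) (hil : i ≠ l) (hjk : j ≠ k) (hjl : j ≠ l) (ht : t ∈ I)
    (hR : HasDerivAt (fun s => dist (X s k) (X s l)) R' t) (hR' : R' ≠ 0) :
    FourBodyHinge (m i) (m j) (m k) (m l) (invCubeDist (X t) i j) (invCubeDist (X t) i k)
      (invCubeDist (X t) i l) (invCubeDist (X t) j k) (invCubeDist (X t) j l)
      (dist (X t i) (X t k) ^ 2 - dist (X t i) (X t l) ^ 2)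
      (dist (X t j) (X t k) ^ 2 - dist (X t j) (X t l) ^ 2) (dist (X t k) (X t l))
      (4 * dist (X t k) (X t l) ^ 2 * spin (X t) (V t) i j k)
      (4 * dist (X t k) (X t l) ^ 2 * spin (X t) (V t) i j l)
      (4 * dist (X t k) (X t l) * spin (X t) (V t) i k l)
      (4 * dist (X t k) (X t l) * spin (X t) (V t) j k l) R' := by
  have compl : ({i, k, l}ᶜ : Finset (Fin 4)) = {j} ∧ ({i, l, k}ᶜ : Finset (Fin 4)) = {j} ∧
      ({j, k, l}ᶜ : Finset (Fin 4)) = {i} ∧ ({j, l, k}ᶜ : Finset (Fin 4)) = {i} ∧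
      ({i, j}ᶜ : Finset (Fin 4)) = {k, l} := by
    clear * - hij hkl hik hil hjk hjl
    decide +revert
  obtain ⟨compl_ikl, compl_ilk, compl_jkl, compl_jlk, compl_ij⟩ := compl
  have spin_ji (p : Fin 4) : spin (X t) (V t) j i p = -spin (X t) (V t) i j p := by
    rw [spin_swap_left, h.inner_velocity_sub_eq_zero (hr i hik hil j) ht, sub_zero]
  have hR_symm : HasDerivAt (fun s => dist (X s l) (X s k)) R' t := by
    simpa only [dist_comm] using hR
  have leg_ik := h.leg_equation hr hkl hik hil ht hR
  have leg_jk := h.leg_equation hr hkl hjk hjl ht hR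
  have leg_il := h.leg_equation hr.symm hkl.symm hil hik ht hR_symm
  have leg_jl := h.leg_equation hr.symm hkl.symm hjl hjk ht hR_symm
  have axis := h.axis_equation hr hik hil hjk hjl ht
  have cocycle := spin_cocycle (X t) (V t) i j k l
  rw [compl_ikl, Finset.sum_singleton] at leg_ik
  rw [compl_jkl, Finset.sum_singleton, invCubeDist_comm _ j i, spin_ji] at leg_jk
  rw [dist_comm (X t l), h.spin_swap_hinge hr hik hil ht hR, compl_ilk,
    Finset.sum_singleton] at leg_il
  rw [dist_comm (X t l), h.spin_swap_hinge hr hjk hjl ht hR, compl_jlk, Finset.sum_singleton,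
    invCubeDist_comm _ j i, spin_ji] at leg_jl
  rw [compl_ij, Finset.sum_pair hkl] at axis
  rw [h.inner_velocity_sub_eq_zero (hr i hik hil k) ht,
    h.inner_velocity_sub_eq_zero (hr j hjk hjl k) ht] at cocycle
  refine ⟨dist_pos.2 (h.collisionFree t ht k l hkl), hR', ?_, ?_, ?_, ?_, ?_, ?_⟩
  · linear_combination leg_ik
  · linear_combination leg_il
  · linear_combination leg_jk
  · linear_combination leg_jl
  · linear_combination 4 * dist (X t k) (X t l) ^ 2 * axis
  · linear_combination -4 * dist (X t k) (X t l) ^ 2 * cocycle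

theorem IsSolution.infinite_dist_image {n : ℕ} {m : Fin n → ℝ}
    {X V : ℝ → Fin n → EuclideanSpace ℝ (Fin d)} {k l : Fin n} (h : IsSolution m I X V)
    (hkl : k ≠ l) (hne : ¬ ConstantDistance I X (k, l)) :
    ((fun s => dist (X s k) (X s l)) ''
      {t ∈ I | deriv (fun s => dist (X s k) (X s l)) t ≠ 0}).Infinite :=
  infinite_image_of_deriv_ne_zero h.ordConnected (fun _ ht => h.hasDerivAt_dist hkl ht) hne

theorem IsRigidExcept.constantDistance_three {m : Fin 3 → ℝ} (hm : ∀ i, m i ≠ 0)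
    {X V : ℝ → Fin 3 → EuclideanSpace ℝ (Fin d)} {k l : Fin 3} (hr : IsRigidExcept I X k l)
    (h : IsSolution m I X V) (hkl : k ≠ l) : ConstantDistance I X (k, l) := by
  by_contra hne
  obtain ⟨i, hik, hil⟩ := (by decide : ∀ k l : Fin 3, ∃ i, i ≠ k ∧ i ≠ l) k l
  have hT := h.infinite_dist_image hkl hne
  obtain ⟨-, t₀, ⟨ht₀, -⟩, -⟩ := hT.nonempty
  refine hT ((finite_setOf_threeBodyHinge (invCubeDist (X t₀) i k) (invCubeDist (X t₀) i l)
    (dist (X t₀ i) (X t₀ k) ^ 2 - dist (X t₀ i) (X t₀ l) ^ 2)).subset ?_)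
  rintro - ⟨t, ⟨ht, hR'⟩, rfl⟩
  have hinge := h.threeBodyHinge hm hr hkl hik hil ht (h.hasDerivAt_dist hkl ht) hR'
  simp only [invCubeDist_congr (hr.dist_eq hik hil _ ht ht₀), hr.dist_eq hik hil _ ht ht₀] at hinge
  exact ⟨_, _, hinge⟩

theorem IsRigidExcept.constantDistance_four {m : Fin 4 → ℝ} (hm : ∀ i, 0 < m i)
    {X V : ℝ → Fin 4 → EuclideanSpace ℝ (Fin d)} {k l : Fin 4} (hr : IsRigidExcept I X k l)
    (h : IsSolution m I X V) (hkl : k ≠ l) : ConstantDistance I X (k, l) := by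
  by_contra hne
  obtain ⟨i, j, hij, hik, hil, hjk, hjl⟩ := (by decide : ∀ k l : Fin 4,
    ∃ i j, i ≠ j ∧ i ≠ k ∧ i ≠ l ∧ j ≠ k ∧ j ≠ l) k l
  have hT := h.infinite_dist_image hkl hne
  obtain ⟨-, t₀, ⟨ht₀, -⟩, -⟩ := hT.nonempty
  have he : invCubeDist (X t₀) i k = invCubeDist (X t₀) j k →
      invCubeDist (X t₀) i l = invCubeDist (X t₀) j l →
      dist (X t₀ i) (X t₀ k) ^ 2 - dist (X t₀ i) (X t₀ l) ^ 2 =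
        dist (X t₀ j) (X t₀ k) ^ 2 - dist (X t₀ j) (X t₀ l) ^ 2 := fun hk hl => by
    rw [dist_eq_of_invCubeDist_eq hk, dist_eq_of_invCubeDist_eq hl]
  refine hT ((finite_setOf_fourBodyHinge (s := invCubeDist (X t₀) i j)
    (hm i) (hm j) (hm k) (hm l) he).subset ?_)
  rintro - ⟨t, ⟨ht, hR'⟩, rfl⟩
  have hinge := h.fourBodyHinge hr hij hkl hik hil hjk hjl ht (h.hasDerivAt_dist hkl ht) hR'
  simp only [invCubeDist_congr (hr.dist_eq hik hil _ ht ht₀), hr.dist_eq hik hil _ ht ht₀,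
    invCubeDist_congr (hr.dist_eq hjk hjl _ ht ht₀), hr.dist_eq hjk hjl _ ht ht₀] at hinge
  exact ⟨_, _, _, _, _, hinge⟩

theorem isRigidExcept_of_forall_pairs {n : ℕ} {X : ℝ → Fin n → EuclideanSpace ℝ (Fin d)}
    {p : Fin n × Fin n} (hc : ∀ q ∈ pairs n, q ≠ p → ConstantDistance I X q) :
    IsRigidExcept I X p.1 p.2 := by
  intro i hik hil j
  have mem_pairs {a b : Fin n} (hab : a < b) : (a, b) ∈ pairs n :=
    Finset.mem_filter.2 ⟨Finset.mem_univ _, hab⟩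
  rcases lt_trichotomy i j with hij | rfl | hji
  · exact hc (i, j) (mem_pairs hij) fun h => hik (congrArg Prod.fst h)
  · exact ⟨0, fun t _ => dist_self _⟩
  · obtain ⟨c, hc⟩ := hc (j, i) (mem_pairs hji) fun h => hil (congrArg Prod.snd h)
    exact ⟨c, fun t ht => (dist_comm _ _).trans (hc t ht)⟩

theorem IsHinged.exists_isRigidExcept {n : ℕ} {X : ℝ → Fin n → EuclideanSpace ℝ (Fin d)}
    (hX : IsHinged I X) :
    ∃ k l, k ≠ l ∧ IsRigidExcept I X k l ∧ ¬ ConstantDistance I X (k, l) := by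
  obtain ⟨p, hp, hne, hc⟩ := hX
  exact ⟨p.1, p.2, (Finset.mem_filter.1 hp).2.ne, isRigidExcept_of_forall_pairs hc, hne⟩

theorem unhinged_three (d : ℕ) : Unhinged 3 d := fun m hm I X V h hX => by
  obtain ⟨k, l, hkl, hr, hne⟩ := hX.exists_isRigidExcept
  exact hne (hr.constantDistance_three (fun i => (hm i).ne') h hkl)

theorem unhinged_four (d : ℕ) : Unhinged 4 d := fun m hm I X V h hX => by
  obtain ⟨k, l, hkl, hr, hne⟩ := hX.exists_isRigidExcept
  exact hne (hr.constantDistance_four hm h hkl)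

theorem Unhinged.rigidWith {n k : ℕ} (h : Unhinged n d) (hk : (pairs n).card = k + 1) :
    RigidWith n d k := by
  intro m hm I X V hX S hS hcard hc
  obtain ⟨p, hp⟩ : ∃ p, pairs n \ S = {p} := by
    rw [← Finset.card_eq_one, Finset.card_sdiff_of_subset hS]
    lia
  have hpn : p ∈ pairs n := (Finset.mem_sdiff.1 (hp ▸ Finset.mem_singleton_self p)).1
  have constant_of_ne : ∀ q ∈ pairs n, q ≠ p → ConstantDistance I X q := fun q hq hqp => by
    refine hc q (by_contra fun hqS => hqp ?_)
    rw [← Finset.mem_singleton, ← hp]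
    exact Finset.mem_sdiff.2 ⟨hq, hqS⟩
  intro q hq
  rcases eq_or_ne q p with rfl | hqp
  · exact by_contra fun hne => h m hm I X V hX ⟨q, hq, hne, constant_of_ne⟩
  · exact constant_of_ne q hq hqp

end Hinge

end NBody

theorem mainTheorem1 (d : ℕ) :
    (NBody.Unhinged 3 d ∧ NBody.RigidWith 3 d 2) ∧
      (NBody.Unhinged 4 d ∧ NBody.RigidWith 4 d 5) :=
  ⟨⟨NBody.unhinged_three d, (NBody.unhinged_three d).rigidWith (by decide)⟩,
    NBody.unhinged_four d, (NBody.unhinged_four d).rigidWith (by decide)⟩
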